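/- **Setting.** For matrices $A_1,\dots,A_p\in\mathbb R^{m\times n}$ let $\mathcal A(M)=(\langle A_i,M\rangle)_{i=1}^p$ with $\langle B,M\rangle=\mathrm{tr}(B^{\mathsf T}M)$. $\mathcal A$ satisfies $2k$-RIP with constant $\delta_{2k}\in(0,1)$ if $(1-\delta_{2k})\|M\|_F^2\le\|\mathcal A(M)\|_2^2\le(1+\delta_{2k})\|M\|_F^2$ for every $M\in\mathbb R^{m\times n}$ of rank at most $2k$. Let $k\ge 1$, let $M^*\in\mathbb R^{m\times n}$ have rank at most $k$, and let the observations be noiseless, $b_i=\langle A_i,M^*\rangle$. For $X\in\mathbb R^{m\times k}$, $Y\in\mathbb R^{n\times k}$ put $r_i=b_i-\langle A_i,XY^{\mathsf T}\rangle$ and $$\mathcal F(X,Y)=\sum_{i=1}^p w_i\,(b_i-\langle A_i,XY^{\mathsf T}\rangle)^2 ,$$ where each weight $w_i$ is either fixed or, more generally, depends on the sign of the residual: $w_i=w_i^{\oplus}$ if $r_i\ge 0$ and $w_i=w_i^{\ominus}$ if $r_i<0$, for given numbers $w_i^{\oplus},w_i^{\ominus}$ (fixed weights are the case $w_i^{\oplus}=w_i^{\ominus}$).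 Alternating minimization on $\mathcal F$ with $T\ge 1$ iterations: let $(\bar X^{(0)},D^{(0)},\bar Y^{(0)})$ be the $k$ largest singular values of $\sum_i b_iA_i$ with corresponding left and right singular vectors; for $t=0,\dots,T-1$ let $Y^{(t+0.5)}\in\arg\min_Y\mathcal F(\bar X^{(t)},Y)$, let $\bar Y^{(t+1)}$ be the orthonormal factor of a QR decomposition of $Y^{(t+0.5)}$, let $X^{(t+0.5)}\in\arg\min_X\mathcal F(X,\bar Y^{(t+1)})$, and let $\bar X^{(t+1)}$ be the orthonormal factor of a QR decomposition of $X^{(t+0.5)}$; output $M^{(T)}=X^{(T-0.5)}\bar Y^{(T)\mathsf T}$. **Theorem.** Let $0<\Sigma_{\min}\le\Sigma_{\max}$. There are constants $C_1,C_2>0$, depending only on $\Sigma_{\min},\Sigma_{\max}$, such that for all $w_-,w_+$ with $0<w_-\le 1/2\le w_+<1$ and $w_-+w_+=1$ there is a constant $c>0$, depending only on $\Sigma_{\min},\Sigma_{\max},w_-,w_+$, with the following property. For all $m,n,p$, all $k\ge1$, all $A_1,\dots,A_p$, and all $M^*$ of rank at most $k$: if $\mathcal A$ satisfies $2k$-RIP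 with some $$\delta_{2k}\le \frac{C_1}{k}\cdot\frac{w_-^2}{w_+^2},$$ if the nonzero singular values $\sigma_1(M^*)\ge\dots\ge\sigma_{\mathrm{rank}(M^*)}(M^*)$ lie in $[\Sigma_{\min},\Sigma_{\max}]$, and if all weights lie in $[w_-,w_+]$, then for every $\varepsilon>0$ and every integer $T\ge1$ with $$T\ \ge\ c\,\bigl(\log(C_2/\varepsilon)+\log(w_- /w_+)\bigr),$$ every output $M^{(T)}$ of $T$ iterations of alternating minimization on $\mathcal F$ satisfies $\|M^{(T)}-M^*\|_F\le\varepsilon$. -/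

import Mathlib

open Matrix

-- Matrices carry the Frobenius norm `‖M‖ = (∑ i j, M i j ^ 2) ^ (1 / 2)`.
attribute [local instance] Matrix.frobeniusNormedAddCommGroup

noncomputable section

namespace WeightedMF

/-- The linear map `𝒜(M) = (⟨A₁, M⟩, …, ⟨A_p, M⟩)` into `ℝ^p` with its Euclidean norm, where
`⟨B, M⟩ = tr(Bᵀ M)`. -/
def measurement {m n p : ℕ} (A : Fin p → Matrix (Fin m) (Fin n) ℝ)
    (M : Matrix (Fin m) (Fin n) ℝ) : EuclideanSpace ℝ (Fin p) :=
  WithLp.toLp 2 fun i => trace ((A i)ᵀ * M)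

/-- Restricted isometry property of order `r` with constant `δ`. -/
def RIP {m n p : ℕ} (A : Fin p → Matrix (Fin m) (Fin n) ℝ) (r : ℕ) (δ : ℝ) : Prop :=
  ∀ M : Matrix (Fin m) (Fin n) ℝ, M.rank ≤ r →
    (1 - δ) * ‖M‖ ^ 2 ≤ ‖measurement A M‖ ^ 2 ∧
      ‖measurement A M‖ ^ 2 ≤ (1 + δ) * ‖M‖ ^ 2

/-- The objective `ℱ(X, Y) = ∑ᵢ wᵢ rᵢ²` with residuals `rᵢ = bᵢ - ⟨Aᵢ, X Yᵀ⟩`. The weight `wᵢ` is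
`wpos i` if `rᵢ ≥ 0` and `wneg i` if `rᵢ < 0`; `wpos = wneg` gives fixed weights. -/
def objective {m n p k : ℕ} (A : Fin p → Matrix (Fin m) (Fin n) ℝ) (b : EuclideanSpace ℝ (Fin p))
    (wpos wneg : Fin p → ℝ) (X : Matrix (Fin m) (Fin k) ℝ) (Y : Matrix (Fin n) (Fin k) ℝ) : ℝ :=
  ∑ i, (if 0 ≤ b i - measurement A (X * Yᵀ) i then wpos i else wneg i) *
    (b i - measurement A (X * Yᵀ) i) ^ 2

/-- `N = P S Qᵀ` is a full singular value decomposition: `P`, `Q` are orthogonal and `S` is the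
rectangular diagonal matrix with nonnegative, nonincreasing diagonal entries `s 0 ≥ s 1 ≥ …`. -/
def IsSVD {m n : ℕ} (N : Matrix (Fin m) (Fin n) ℝ) (P : Matrix (Fin m) (Fin m) ℝ) (s : ℕ → ℝ)
    (Q : Matrix (Fin n) (Fin n) ℝ) : Prop :=
  P ∈ orthogonalGroup (Fin m) ℝ ∧ Q ∈ orthogonalGroup (Fin n) ℝ ∧ Antitone s ∧ (∀ i, 0 ≤ s i) ∧
    N = P * (Matrix.of fun (i : Fin m) (j : Fin n) => if (i : ℕ) = (j : ℕ) then s i else 0) * Qᵀ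

/-- `(X, D, Y) = SVD_k(N)`: the top `k` singular values of `N`, with corresponding left and right
singular vectors. -/
def IsTopSVD {m n k : ℕ} (N : Matrix (Fin m) (Fin n) ℝ) (X : Matrix (Fin m) (Fin k) ℝ)
    (D : Matrix (Fin k) (Fin k) ℝ) (Y : Matrix (Fin n) (Fin k) ℝ) : Prop :=
  ∃ (hm : k ≤ m) (hn : k ≤ n) (P : Matrix (Fin m) (Fin m) ℝ) (s : ℕ → ℝ)
    (Q : Matrix (Fin n) (Fin n) ℝ), IsSVD N P s Q ∧
      X = P.submatrix id (Fin.castLE hm) ∧ D = diagonal (fun a : Fin k => s a) ∧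
      Y = Q.submatrix id (Fin.castLE hn)

/-- `Z = Zbar R` is a QR decomposition of `Z`: `Zbar` has orthonormal columns, `R` is upper
triangular. -/
def IsQR {d k : ℕ} (Z Zbar : Matrix (Fin d) (Fin k) ℝ) : Prop :=
  Zbarᵀ * Zbar = 1 ∧ ∃ R : Matrix (Fin k) (Fin k) ℝ, R.BlockTriangular id ∧ Z = Zbar * R

/-- `T` iterations of alternating minimization on `objective A b wpos wneg`. Here `Xbar t`, `Ybar t`
are the orthonormal iterates `X̄^(t)`, `Ȳ^(t)`, and `Xhalf t`, `Yhalf t` are the block minimizers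
`X^(t+0.5)`, `Y^(t+0.5)`. -/
structure IsRun {m n p k : ℕ} (A : Fin p → Matrix (Fin m) (Fin n) ℝ) (b : EuclideanSpace ℝ (Fin p))
    (wpos wneg : Fin p → ℝ) (T : ℕ)
    (Xbar Xhalf : ℕ → Matrix (Fin m) (Fin k) ℝ) (Ybar Yhalf : ℕ → Matrix (Fin n) (Fin k) ℝ) :
    Prop where
  init : ∃ D : Matrix (Fin k) (Fin k) ℝ, IsTopSVD (∑ i, b i • A i) (Xbar 0) D (Ybar 0)
  minY : ∀ t < T, IsMinOn (fun Y => objective A b wpos wneg (Xbar t) Y) Set.univ (Yhalf t)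
  qrY : ∀ t < T, IsQR (Yhalf t) (Ybar (t + 1))
  minX : ∀ t < T, IsMinOn (fun X => objective A b wpos wneg X (Ybar (t + 1))) Set.univ (Xhalf t)
  qrX : ∀ t < T, IsQR (Xhalf t) (Xbar (t + 1))

end WeightedMF

end

noncomputable section

namespace WeightedMF

/-! ### Frobenius geometry and orthogonal projections. -/

section Frobenius

variable {l m n : Type*} [Fintype l] [Fintype m] [Fintype n]

/-! Alternating minimization is analysed as descent on the loss `f(E) = ∑ wᵢ ⟨Aᵢ, E⟩²` of the
residual `E = M - X Yᵀ`. Even where residuals change sign, `w(r) r²` stays below a quadratic model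
with leading coefficient `whi` (`signed_sq_smooth`), which gives a descent inequality. RIP and the
weight bounds make `f(E)` comparable to `‖E‖²` at rank at most `2k`.

If `Y` is optimal for `X`, the derivative of `f` at `E` vanishes along every `X Zᵀ`. Modulo such
directions, `E` is the sum of `G = E Ȳ Ȳᵀ`, which an update of `X` can change, and `B = (1 - X Xᵀ) M
(1 - Ȳ Ȳᵀ)`. Both one-sided blocks of `M` are blocks of `E`, and the nonzero singular values of `M`
are at least `Smin`, so `‖B‖ ≤ ‖E‖² / Smin`. Since half the derivative along `E` equals `f(E)`, the
part along `G` is at least `f(E) / 2` once `E` is small. A gradient step along `G` then contracts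
the loss, and the exact minimizer over `X` does at least as well (`exists_residualLoss_le_mul`). The
next `Y` update need only not increase the loss, so smallness persists
(`IsRun.residualLoss_le_pow_mul`).

Smallness at the start comes from the spectral initialization: RIP makes `∑ bᵢ Aᵢ` close to `M` when
tested on matrices of rank at most `k`, so the initial column space misses only `O(k δ)` of `M`
(`RIP.norm_complement_init_le`). -/

theorem frobenius_norm_sq_eq_sum (M : Matrix m n ℝ) : ‖M‖ ^ 2 = ∑ i, ∑ j, M i j ^ 2 := by
  rw [frobenius_norm_def, ← Real.sqrt_eq_rpow, Real.sq_sqrt (by positivity)]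
  simp

theorem trace_transpose_mul_eq_sum (M N : Matrix m n ℝ) :
    trace (Mᵀ * N) = ∑ i, ∑ j, M i j * N i j := by
  simp only [trace, diag_apply, mul_apply, transpose_apply]
  exact Finset.sum_comm

theorem frobenius_norm_sq_eq_trace (M : Matrix m n ℝ) : ‖M‖ ^ 2 = trace (Mᵀ * M) := by
  rw [frobenius_norm_sq_eq_sum, trace_transpose_mul_eq_sum]
  simp only [sq]

theorem trace_transpose_mul_comm (M N : Matrix m n ℝ) : trace (Mᵀ * N) = trace (Nᵀ * M) := by
  simp only [trace_transpose_mul_eq_sum, mul_comm]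

theorem frobenius_norm_add_sq (M N : Matrix m n ℝ) :
    ‖M + N‖ ^ 2 = ‖M‖ ^ 2 + 2 * trace (Mᵀ * N) + ‖N‖ ^ 2 := by
  simp only [frobenius_norm_sq_eq_trace, transpose_add, Matrix.add_mul, Matrix.mul_add, trace_add]
  rw [trace_transpose_mul_comm N M]
  ring

theorem frobenius_norm_smul_sq (t : ℝ) (M : Matrix m n ℝ) : ‖t • M‖ ^ 2 = t ^ 2 * ‖M‖ ^ 2 := by
  simp only [frobenius_norm_sq_eq_sum, Finset.mul_sum, Matrix.smul_apply, smul_eq_mul, mul_pow]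

/-- The Cauchy–Schwarz inequality for the Frobenius inner product. -/
theorem trace_transpose_mul_le (M N : Matrix m n ℝ) : trace (Mᵀ * N) ≤ ‖M‖ * ‖N‖ := by
  refine (le_abs_self _).trans (abs_le_of_sq_le_sq ?_ (by positivity))
  rw [mul_pow, frobenius_norm_sq_eq_sum, frobenius_norm_sq_eq_sum, trace_transpose_mul_eq_sum]
  simp only [← Fintype.sum_prod_type']
  exact Finset.sum_mul_sq_le_sq_mul_sq _ _ _

theorem frobenius_norm_isometry_mul [DecidableEq n] {P : Matrix m n ℝ} (hP : Pᵀ * P = 1)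
    (M : Matrix n l ℝ) : ‖P * M‖ = ‖M‖ := by
  rw [← sq_eq_sq₀ (norm_nonneg _) (norm_nonneg _), frobenius_norm_sq_eq_trace,
    frobenius_norm_sq_eq_trace, transpose_mul, Matrix.mul_assoc, ← Matrix.mul_assoc Pᵀ, hP,
    Matrix.one_mul]

theorem frobenius_norm_mul_transpose_isometry [DecidableEq n] {P : Matrix m n ℝ} (hP : Pᵀ * P = 1)
    (M : Matrix l n ℝ) : ‖M * Pᵀ‖ = ‖M‖ := by
  rw [← frobenius_norm_transpose, transpose_mul, transpose_transpose,
    frobenius_norm_isometry_mul hP, frobenius_norm_transpose]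

theorem frobenius_norm_sq_projection_mul {P : Matrix m m ℝ} (hPs : Pᵀ = P) (hP : P * P = P)
    (M : Matrix m n ℝ) : ‖P * M‖ ^ 2 = trace (Mᵀ * (P * M)) := by
  rw [frobenius_norm_sq_eq_trace, transpose_mul, Matrix.mul_assoc, ← Matrix.mul_assoc Pᵀ, hPs, hP]

/-- Orthogonal projections do not increase the Frobenius norm. -/
theorem frobenius_norm_projection_mul_le {P : Matrix m m ℝ} (hPs : Pᵀ = P) (hP : P * P = P)
    (M : Matrix m n ℝ) : ‖P * M‖ ≤ ‖M‖ := by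
  have h1 := frobenius_norm_sq_projection_mul hPs hP M
  have h2 := trace_transpose_mul_le M (P * M)
  rcases (norm_nonneg (P * M)).eq_or_lt with h | h
  · rw [← h]; positivity
  · nlinarith

theorem frobenius_norm_mul_projection_le {P : Matrix n n ℝ} (hPs : Pᵀ = P) (hP : P * P = P)
    (M : Matrix m n ℝ) : ‖M * P‖ ≤ ‖M‖ := by
  rw [← frobenius_norm_transpose, transpose_mul, ← frobenius_norm_transpose M, hPs]
  exact frobenius_norm_projection_mul_le hPs hP _

theorem frobenius_norm_mul_isometry_le [DecidableEq n] {P : Matrix m n ℝ} (hP : Pᵀ * P = 1)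
    (M : Matrix l m ℝ) : ‖M * P‖ ≤ ‖M‖ := by
  rw [← frobenius_norm_mul_transpose_isometry hP, Matrix.mul_assoc]
  refine frobenius_norm_mul_projection_le (by simp) ?_ M
  rw [Matrix.mul_assoc, ← Matrix.mul_assoc Pᵀ, hP, Matrix.one_mul]

end Frobenius

theorem transpose_one_sub_mul_transpose {m n : Type*} [Fintype n] [DecidableEq m]
    (X : Matrix m n ℝ) : (1 - X * Xᵀ)ᵀ = 1 - X * Xᵀ := by simp

section Complement

variable {m n : Type*} [Fintype m] [Fintype n] [DecidableEq m] [DecidableEq n]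

theorem isIdempotent_one_sub_mul_transpose {X : Matrix m n ℝ} (hX : Xᵀ * X = 1) :
    (1 - X * Xᵀ) * (1 - X * Xᵀ) = 1 - X * Xᵀ := by
  have : X * Xᵀ * (X * Xᵀ) = X * Xᵀ := by
    rw [Matrix.mul_assoc, ← Matrix.mul_assoc Xᵀ, hX, Matrix.one_mul]
  rw [Matrix.sub_mul, Matrix.one_mul, Matrix.mul_sub, Matrix.mul_one, this, sub_self, sub_zero]

theorem one_sub_mul_transpose_mul_self {X : Matrix m n ℝ} (hX : Xᵀ * X = 1) :
    (1 - X * Xᵀ) * X = 0 := by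
  rw [Matrix.sub_mul, Matrix.mul_assoc, hX, Matrix.one_mul, Matrix.mul_one, sub_self]

theorem transpose_mul_one_sub_mul_transpose {X : Matrix m n ℝ} (hX : Xᵀ * X = 1) :
    Xᵀ * (1 - X * Xᵀ) = 0 := by
  rw [Matrix.mul_sub, ← Matrix.mul_assoc, hX, Matrix.one_mul, Matrix.mul_one, sub_self]

end Complement

/-! ### The measurement map and restricted isometry. -/

section Measurement

variable {m n p : ℕ} (A : Fin p → Matrix (Fin m) (Fin n) ℝ)

theorem measurement_apply (M : Matrix (Fin m) (Fin n) ℝ) (i : Fin p) :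
    measurement A M i = trace ((A i)ᵀ * M) := rfl

theorem measurement_add (M N : Matrix (Fin m) (Fin n) ℝ) (i : Fin p) :
    measurement A (M + N) i = measurement A M i + measurement A N i := by
  simp [measurement_apply, Matrix.mul_add]

theorem measurement_sub (M N : Matrix (Fin m) (Fin n) ℝ) (i : Fin p) :
    measurement A (M - N) i = measurement A M i - measurement A N i := by
  simp [measurement_apply, Matrix.mul_sub]

theorem measurement_smul (t : ℝ) (M : Matrix (Fin m) (Fin n) ℝ) (i : Fin p) :
    measurement A (t • M) i = t * measurement A M i := by
  simp [measurement_apply]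

theorem norm_measurement_sq (M : Matrix (Fin m) (Fin n) ℝ) :
    ‖measurement A M‖ ^ 2 = ∑ i, measurement A M i ^ 2 := by
  simp [EuclideanSpace.norm_sq_eq]

theorem trace_sum_smul_transpose_mul (b : Fin p → ℝ) (Z : Matrix (Fin m) (Fin n) ℝ) :
    trace ((∑ i, b i • A i)ᵀ * Z) = ∑ i, b i * measurement A Z i := by
  simp [measurement_apply, transpose_sum, Matrix.sum_mul, trace_sum]

end Measurement

theorem rank_add_le_add_rank {m n : ℕ} (M N : Matrix (Fin m) (Fin n) ℝ) :
    (M + N).rank ≤ M.rank + N.rank := by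
  refine le_trans (Submodule.finrank_mono ?_)
    (Submodule.finrank_add_le_finrank_add_finrank (LinearMap.range M.mulVecLin)
      (LinearMap.range N.mulVecLin))
  rintro _ ⟨v, rfl⟩
  rw [mulVecLin_add, LinearMap.add_apply]
  exact Submodule.add_mem_sup ⟨v, rfl⟩ ⟨v, rfl⟩

theorem rank_add_smul_le {m n k : ℕ} {M Z : Matrix (Fin m) (Fin n) ℝ} (hM : M.rank ≤ k)
    (hZ : Z.rank ≤ k) (t : ℝ) : (M + t • Z).rank ≤ 2 * k := by
  have h1 := rank_add_le_add_rank M (t • Z)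
  have h2 : (t • Z).rank ≤ Z.rank := by
    rw [← Matrix.mul_one Z, ← Matrix.mul_smul]
    simpa using Matrix.rank_mul_le_left Z (t • (1 : Matrix (Fin n) (Fin n) ℝ))
  omega

/-- The restricted isometry property controls inner products of matrices of half the rank. -/
theorem RIP.abs_inner_sub_le {m n p k : ℕ} {A : Fin p → Matrix (Fin m) (Fin n) ℝ} {δ : ℝ}
    (hA : RIP A (2 * k) δ) {M Z : Matrix (Fin m) (Fin n) ℝ}
    (hM : M.rank ≤ k) (hZ : Z.rank ≤ k) (hδ : 0 ≤ δ) :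
    |∑ i, measurement A M i * measurement A Z i - trace (Mᵀ * Z)| ≤ δ * ‖M‖ * ‖Z‖ := by
  set d := ∑ i, measurement A M i * measurement A Z i - trace (Mᵀ * Z) with hd
  have expand (t : ℝ) : ‖measurement A (M + t • Z)‖ ^ 2 =
      ‖measurement A M‖ ^ 2 + 2 * t * ∑ i, measurement A M i * measurement A Z i
        + t ^ 2 * ‖measurement A Z‖ ^ 2 := by
    simp only [norm_measurement_sq, measurement_add, measurement_smul, Finset.mul_sum,
      ← Finset.sum_add_distrib]
    exact Finset.sum_congr rfl fun i _ => by ring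
  have expand' (t : ℝ) : ‖M + t • Z‖ ^ 2 = ‖M‖ ^ 2 + 2 * t * trace (Mᵀ * Z) + t ^ 2 * ‖Z‖ ^ 2 := by
    rw [frobenius_norm_add_sq, frobenius_norm_smul_sq, Matrix.mul_smul, trace_smul, smul_eq_mul]
    ring
  -- Polarization: subtract the lower RIP bound at `M - t Z` from the upper one at `M + t Z`. The
  -- discriminant of the resulting quadratic in `t` gives the claim.
  have key (t : ℝ) : 0 ≤ (δ * ‖Z‖ ^ 2) * (t * t) + (-(2 * d)) * t + δ * ‖M‖ ^ 2 := by
    have h1 := (hA _ (rank_add_smul_le hM hZ t)).2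
    have h2 := (hA _ (rank_add_smul_le hM hZ (-t))).1
    rw [expand, expand'] at h1 h2
    rw [hd]
    nlinarith
  have := discrim_le_zero key
  refine abs_le_of_sq_le_sq (by rw [discrim] at this; nlinarith) (by positivity)

/-! ### Singular values and the row space. -/

section Spectral

variable {m n : ℕ}

/-- A nonzero eigenvalue of `Mᵀ M` is the square of one of the first `rank M` singular values. -/
theorem exists_sq_singularValues_eq_eigenvalues (M : Matrix (Fin m) (Fin n) ℝ)
    (hM : (Mᵀ * M).IsHermitian) (i : Fin n) (hi : hM.eigenvalues i ≠ 0) :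
    ∃ j < M.rank, (Matrix.toEuclideanLin M).singularValues j ^ 2 = hM.eigenvalues i := by
  set L := Matrix.toEuclideanLin M with hL
  have hadj : LinearMap.adjoint L ∘ₗ L = Matrix.toEuclideanLin (Mᵀ * M) := by
    rw [hL, ← Matrix.toEuclideanLin_conjTranspose_eq_adjoint, conjTranspose_eq_transpose_of_trivial]
    ext v
    simp [toLpLin_apply, mulVec_mulVec]
  have hev : Module.End.HasEigenvalue (LinearMap.adjoint L ∘ₗ L) (hM.eigenvalues i) := by
    rw [hadj]
    refine Module.End.hasEigenvalue_of_hasEigenvector (x := hM.eigenvectorBasis i) ⟨?_, ?_⟩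
    · rw [Module.End.mem_eigenspace_iff]
      ext a
      have := congrFun (hM.mulVec_eigenvectorBasis i) a
      simpa [toLpLin_apply] using this
    · exact hM.eigenvectorBasis.orthonormal.ne_zero i
  obtain ⟨j, hj⟩ := L.isSymmetric_adjoint_comp_self.exists_eigenvalues_eq
    (finrank_euclideanSpace_fin (n := n)) hev
  have hsq := L.sq_singularValues_fin (finrank_euclideanSpace_fin (n := n)) j
  have hj' : L.singularValues j ^ 2 = hM.eigenvalues i := by
    rw [hsq]; exact_mod_cast hj
  refine ⟨j, ?_, hj'⟩
  have hpos : 0 < L.singularValues j := by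
    rw [LinearMap.singularValues_pos_iff_ne_zero]
    intro h
    rw [h] at hj'
    exact hi (by rw [← hj']; norm_num)
  rw [LinearMap.singularValues_pos_iff_lt_finrank_range] at hpos
  rwa [hL, Matrix.toEuclideanLin_eq_toLin_orthonormal,
    ← Matrix.rank_eq_finrank_range_toLin M (EuclideanSpace.basisFun (Fin m) ℝ).toBasis
      (EuclideanSpace.basisFun (Fin n) ℝ).toBasis] at hpos

theorem frobenius_norm_sq_diagonal_mul (d : Fin n → ℝ) (B : Matrix (Fin n) (Fin m) ℝ) :
    ‖diagonal d * B‖ ^ 2 = ∑ i, d i ^ 2 * ∑ j, B i j ^ 2 := by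
  simp only [frobenius_norm_sq_eq_sum, diagonal_mul, mul_pow, Finset.mul_sum]

theorem trace_transpose_mul_diagonal_mul (d : Fin n → ℝ) (B : Matrix (Fin n) (Fin m) ℝ) :
    trace (Bᵀ * (diagonal d * B)) = ∑ i, d i * ∑ j, B i j ^ 2 := by
  rw [trace_transpose_mul_eq_sum]
  simp only [diagonal_mul, Finset.mul_sum]
  exact Finset.sum_congr rfl fun i _ => Finset.sum_congr rfl fun j _ => by ring

/-- The orthogonal projection `P` onto the row space of `M`, with the bounds that the nonzero
singular values of `M` give. -/
theorem exists_rowSpace_projection {k : ℕ} (M : Matrix (Fin m) (Fin n) ℝ) (hk : M.rank ≤ k)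
    {Smin Smax : ℝ} (hSmin : 0 < Smin)
    (hs : ∀ i < M.rank, (Matrix.toEuclideanLin M).singularValues i ∈ Set.Icc Smin Smax) :
    ∃ P : Matrix (Fin n) (Fin n) ℝ, M * P = M ∧ ‖P‖ ^ 2 ≤ k ∧ ‖M‖ ^ 2 ≤ k * Smax ^ 2 ∧
      ∀ B : Matrix (Fin n) (Fin n) ℝ, Smin * ‖P * B‖ ≤ ‖M * B‖ := by
  have hM : (Mᵀ * M).IsHermitian := by
    rw [← conjTranspose_eq_transpose_of_trivial]
    exact isHermitian_conjTranspose_mul_self M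
  set ev := hM.eigenvalues with hev
  set V : Matrix (Fin n) (Fin n) ℝ := hM.eigenvectorUnitary.1 with hV
  have hVV : Vᵀ * V = 1 := by
    simpa [star_eq_conjTranspose] using Unitary.coe_star_mul_self hM.eigenvectorUnitary
  have hVV' : V * Vᵀ = 1 := by
    simpa [star_eq_conjTranspose] using Unitary.coe_mul_star_self hM.eigenvectorUnitary
  have hspec : Mᵀ * M = V * (diagonal ev * Vᵀ) := by
    have := hM.spectral_theorem
    rw [Unitary.conjStarAlgAut_apply] at this
    rw [← Matrix.mul_assoc]
    simpa [star_eq_conjTranspose] using this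
  have hnorm {l : ℕ} (B : Matrix (Fin n) (Fin l) ℝ) :
      ‖M * B‖ ^ 2 = ∑ i, ev i * ∑ j, (Vᵀ * B) i j ^ 2 := by
    rw [← trace_transpose_mul_diagonal_mul, frobenius_norm_sq_eq_trace]
    congr 1
    rw [transpose_mul, transpose_mul, transpose_transpose, Matrix.mul_assoc, ← Matrix.mul_assoc Mᵀ,
      hspec]
    simp only [Matrix.mul_assoc]
  have hbound (i) (hi : ev i ≠ 0) : Smin ^ 2 ≤ ev i ∧ ev i ≤ Smax ^ 2 := by
    obtain ⟨j, hj, h⟩ := exists_sq_singularValues_eq_eigenvalues M hM i hi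
    obtain ⟨h1, h2⟩ := hs j hj
    rw [hev, ← h]
    exact ⟨pow_le_pow_left₀ hSmin.le h1 2, pow_le_pow_left₀ (hSmin.le.trans h1) h2 2⟩
  -- Indicator of the nonzero eigenvalues of `Mᵀ M`; the projection is `V diag(χ) Vᵀ`.
  set χ : Fin n → ℝ := fun i => if ev i ≠ 0 then 1 else 0 with hχ
  have hcard : ∑ i, χ i ≤ k := by
    have h1 : M.rank = Fintype.card {i // ev i ≠ 0} := by
      rw [← hM.rank_eq_card_non_zero_eigs, rank_transpose_mul_self]
    rw [hχ, Finset.sum_boole, ← Fintype.card_subtype, ← h1]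
    exact_mod_cast hk
  have hVrow (i) : ∑ j, Vᵀ i j ^ 2 = 1 := by
    have := congrFun (congrFun hVV i) i
    rw [mul_apply, one_apply_eq] at this
    rw [← this]
    exact Finset.sum_congr rfl fun j _ => by rw [transpose_apply, sq]
  refine ⟨V * (diagonal χ * Vᵀ), ?_, ?_, ?_, fun B => ?_⟩
  · rw [← sub_eq_zero, ← norm_eq_zero, ← sq_eq_zero_iff,
      show M * (V * (diagonal χ * Vᵀ)) - M = M * (V * ((diagonal χ - 1) * Vᵀ)) by
        rw [Matrix.sub_mul, Matrix.mul_sub, Matrix.one_mul, hVV', Matrix.mul_sub, Matrix.mul_one],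
      hnorm, ← Matrix.mul_assoc Vᵀ, hVV, Matrix.one_mul, ← diagonal_one, diagonal_sub]
    refine Finset.sum_eq_zero fun i _ => ?_
    by_cases hi : ev i = 0
    · simp [hi]
    · simp [hχ, hi]
  · rw [frobenius_norm_isometry_mul hVV, frobenius_norm_sq_diagonal_mul]
    refine le_trans (le_of_eq (Finset.sum_congr rfl fun i _ => ?_)) hcard
    rw [hVrow, hχ]
    simp
  · have := hnorm (1 : Matrix (Fin n) (Fin n) ℝ)
    rw [Matrix.mul_one, Matrix.mul_one] at this
    rw [this]
    refine le_trans (Finset.sum_le_sum (g := fun i => χ i * Smax ^ 2) fun i _ => ?_) ?_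
    · rw [hVrow, mul_one]
      by_cases hi : ev i = 0
      · simp [hi, hχ]
      · simpa [hχ, hi] using (hbound i hi).2
    · rw [← Finset.sum_mul]
      gcongr
  · refine le_of_sq_le_sq ?_ (norm_nonneg _)
    rw [Matrix.mul_assoc, Matrix.mul_assoc, frobenius_norm_isometry_mul hVV, mul_pow,
      frobenius_norm_sq_diagonal_mul, hnorm, Finset.mul_sum]
    refine Finset.sum_le_sum fun i _ => ?_
    rw [← mul_assoc]
    refine mul_le_mul_of_nonneg_right ?_ (Finset.sum_nonneg fun j _ => sq_nonneg _)
    by_cases hi : ev i = 0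
    · simp [hi, hχ]
    · simpa [hχ, hi] using (hbound i hi).1

/-- A block of `M` off its approximate column and row spaces is quadratically small. -/
theorem norm_mul_mul_le_div {k : ℕ} (M : Matrix (Fin m) (Fin n) ℝ)
    {Smin : ℝ} (hSmin : 0 < Smin) {P : Matrix (Fin n) (Fin n) ℝ} (hP : M * P = M)
    (hPB : ∀ B : Matrix (Fin n) (Fin n) ℝ, Smin * ‖P * B‖ ≤ ‖M * B‖)
    (L : Matrix (Fin k) (Fin m) ℝ) (R : Matrix (Fin n) (Fin n) ℝ) :
    ‖L * M * R‖ ≤ ‖L * M‖ * ‖M * R‖ / Smin := by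
  rw [le_div_iff₀ hSmin]
  -- Inserting `P` after `M` lets the norm split into two factors, and `‖P R‖` costs only `‖M R‖ /
  -- Smin`.
  have h1 : ‖L * M * R‖ ≤ ‖L * M‖ * ‖P * R‖ := by
    calc ‖L * M * R‖ = ‖L * M * (P * R)‖ := by
          rw [← Matrix.mul_assoc, Matrix.mul_assoc L M P, hP]
      _ ≤ _ := frobenius_norm_mul _ _
  nlinarith [hPB R, norm_nonneg (L * M)]

end Spectral

/-! ### Spectral initialization. -/

section Initialization

variable {m n : ℕ}

/-- Handles the rectangular diagonal of an SVD, where a row index may have no matching column. -/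
theorem sum_ite_val_eq {n : ℕ} (a : ℕ) (f : Fin n → ℝ) :
    ∑ b : Fin n, (if a = (b : ℕ) then f b else 0) = if h : a < n then f ⟨a, h⟩ else 0 := by
  split_ifs with h
  · rw [Finset.sum_eq_single ⟨a, h⟩]
    · simp
    · rintro b - hb
      rw [if_neg]
      rintro rfl
      exact hb rfl
    · simp
  · exact Finset.sum_eq_zero fun b _ => if_neg (by have := b.2; omega)

theorem orthogonalGroup_transpose_mul {P : Matrix (Fin m) (Fin m) ℝ}
    (hP : P ∈ orthogonalGroup (Fin m) ℝ) : Pᵀ * P = 1 := by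
  simpa [star_eq_conjTranspose] using (mem_orthogonalGroup_iff' (Fin m) ℝ).1 hP

theorem submatrix_transpose_mul_submatrix {l : ℕ} {P : Matrix (Fin m) (Fin m) ℝ}
    (hP : Pᵀ * P = 1) (hl : l ≤ m) :
    (P.submatrix id (Fin.castLE hl))ᵀ * P.submatrix id (Fin.castLE hl) = 1 := by
  rw [show (P.submatrix id (Fin.castLE hl))ᵀ * P.submatrix id (Fin.castLE hl) =
    (Pᵀ * P).submatrix (Fin.castLE hl) (Fin.castLE hl) from rfl, hP]
  exact submatrix_one _ (Fin.castLE_injective hl)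

theorem IsSVD.mul_submatrix {N : Matrix (Fin m) (Fin n) ℝ} {P : Matrix (Fin m) (Fin m) ℝ}
    {s : ℕ → ℝ} {Q : Matrix (Fin n) (Fin n) ℝ} (h : IsSVD N P s Q) {l : ℕ} (hm : l ≤ m)
    (hn : l ≤ n) : N * Q.submatrix id (Fin.castLE hn) =
      P.submatrix id (Fin.castLE hm) * diagonal fun a : Fin l => s a := by
  obtain ⟨-, hQ, -, -, rfl⟩ := h
  ext a b
  rw [mul_diagonal, show ∀ L : Matrix (Fin m) (Fin n) ℝ,
    (L * Q.submatrix id (Fin.castLE hn)) a b = (L * Q) a (Fin.castLE hn b) from fun L => rfl,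
    Matrix.mul_assoc, orthogonalGroup_transpose_mul hQ, Matrix.mul_one, mul_apply,
    Finset.sum_eq_single (Fin.castLE hm b)]
  · simp
  · intro x _ hx
    rw [of_apply, if_neg, mul_zero]
    intro h
    exact hx (Fin.ext h)
  · simp

/-- A matrix of rank less than its number of columns kills a nonzero column vector. -/
theorem exists_mul_eq_zero_of_rank_lt {l : ℕ} (M : Matrix (Fin m) (Fin l) ℝ) (h : M.rank < l) :
    ∃ C : Matrix (Fin l) (Fin 1) ℝ, C ≠ 0 ∧ M * C = 0 := by
  have hker : LinearMap.ker M.mulVecLin ≠ ⊥ := by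
    intro hb
    have := M.mulVecLin.finrank_range_add_finrank_ker
    rw [hb, finrank_bot] at this
    simp only [add_zero, Module.finrank_fintype_fun_eq_card, Fintype.card_fin] at this
    exact h.ne this
  obtain ⟨c, hc, hc0⟩ := Submodule.exists_mem_ne_zero_of_ne_bot hker
  refine ⟨replicateCol (Fin 1) c, ?_, ?_⟩
  · intro h0
    exact hc0 (funext fun i => by simpa using congrFun (congrFun h0 i) 0)
  · rw [LinearMap.mem_ker, mulVecLin_apply] at hc
    rw [← replicateCol_mulVec, hc]
    rfl

variable {p k : ℕ} {A : Fin p → Matrix (Fin m) (Fin n) ℝ} {δ : ℝ}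

/-- Weyl's inequality for the tail singular values of the backprojection `𝒜ᵀ 𝒜 M`. -/
theorem RIP.tail_singularValue_le (hA : RIP A (2 * k) δ) (hδ : 0 ≤ δ) (hk : 0 < k)
    {M : Matrix (Fin m) (Fin n) ℝ} (hM : M.rank ≤ k) {P : Matrix (Fin m) (Fin m) ℝ} {s : ℕ → ℝ}
    {Q : Matrix (Fin n) (Fin n) ℝ} (h : IsSVD (∑ i, measurement A M i • A i) P s Q) {i : ℕ}
    (hki : k ≤ i) (him : i < m) (hin : i < n) : s i ≤ δ * ‖M‖ := by
  have hm : k + 1 ≤ m := by omega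
  have hn : k + 1 ≤ n := by omega
  set N := ∑ i, measurement A M i • A i with hN
  -- The first `k + 1` right singular vectors span a space too large for `M` to be injective on it;
  -- `v` is a kernel vector there, and `N` stretches it by at least `s k ≥ s i`.
  obtain ⟨C, hC0, hC⟩ := exists_mul_eq_zero_of_rank_lt (M * Q.submatrix id (Fin.castLE hn))
    ((rank_mul_le_left _ _).trans_lt (by omega))
  set v := Q.submatrix id (Fin.castLE hn) * C with hv
  have hMv : M * v = 0 := by rw [hv, ← Matrix.mul_assoc, hC]
  have hvC : ‖v‖ = ‖C‖ := frobenius_norm_isometry_mul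
    (submatrix_transpose_mul_submatrix (orthogonalGroup_transpose_mul h.2.1) hn) _
  have hCpos : 0 < ‖C‖ := norm_pos_iff.2 hC0
  have hsi : 0 ≤ s i := h.2.2.2.1 i
  have hlow : s i * ‖v‖ ≤ ‖N * v‖ := by
    refine le_of_sq_le_sq ?_ (norm_nonneg _)
    rw [hvC, hv, ← Matrix.mul_assoc, h.mul_submatrix hm hn, Matrix.mul_assoc,
      frobenius_norm_isometry_mul
        (submatrix_transpose_mul_submatrix (orthogonalGroup_transpose_mul h.1) hm),
      frobenius_norm_sq_diagonal_mul, mul_pow, frobenius_norm_sq_eq_sum, Finset.mul_sum]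
    refine Finset.sum_le_sum fun a _ => ?_
    have : s i ≤ s a := h.2.2.1 (by have := a.2; omega)
    gcongr
  have hup : ‖N * v‖ ^ 2 ≤ δ * ‖M‖ * (‖N * v‖ * ‖v‖) := by
    -- Rank-one test matrix with `⟨N, Z⟩ = ‖N v‖²` and `⟨M, Z⟩ = 0`.
    set Z := N * v * vᵀ with hZ
    have hZr : Z.rank ≤ k :=
      (rank_mul_le_right _ _).trans ((rank_le_height _).trans hk)
    have h1 := (le_abs_self _).trans (hA.abs_inner_sub_le hM hZr hδ)
    have h2 : ∑ i, measurement A M i * measurement A Z i = ‖N * v‖ ^ 2 := by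
      rw [← trace_sum_smul_transpose_mul, ← hN, hZ, frobenius_norm_sq_eq_trace, ← Matrix.mul_assoc,
        trace_mul_comm, ← Matrix.mul_assoc, ← transpose_mul]
    have h3 : trace (Mᵀ * Z) = 0 := by
      rw [hZ, ← Matrix.mul_assoc, trace_mul_comm, ← Matrix.mul_assoc, ← transpose_mul, hMv]
      simp
    have h4 : ‖Z‖ ≤ ‖N * v‖ * ‖v‖ := by
      rw [← frobenius_norm_transpose v]
      exact frobenius_norm_mul _ _
    rw [h2, h3, sub_zero] at h1
    exact h1.trans (by gcongr)
  have hvpos : 0 < ‖v‖ := hvC ▸ hCpos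
  have hle : ‖N * v‖ ≤ δ * ‖M‖ * ‖v‖ := by
    rcases (norm_nonneg (N * v)).eq_or_lt with h0 | h0
    · rw [← h0]; positivity
    · nlinarith
  exact le_of_mul_le_mul_right (hlow.trans hle) hvpos

/-- The part of `N` outside its top `k` left singular vectors has operator norm at most any bound
on the tail singular values. -/
theorem IsSVD.norm_complement_mul_le {N : Matrix (Fin m) (Fin n) ℝ} {P : Matrix (Fin m) (Fin m) ℝ}
    {s : ℕ → ℝ} {Q : Matrix (Fin n) (Fin n) ℝ} (h : IsSVD N P s Q) {τ : ℝ} (hτ : 0 ≤ τ)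
    (hs : ∀ i, k ≤ i → i < m → i < n → s i ≤ τ) (hm : k ≤ m) {l : ℕ}
    (B : Matrix (Fin n) (Fin l) ℝ) :
    ‖(1 - P.submatrix id (Fin.castLE hm) * (P.submatrix id (Fin.castLE hm))ᵀ) * (N * B)‖
      ≤ τ * ‖B‖ := by
  obtain ⟨hP, hQ, -, hs0, rfl⟩ := h
  have hPP := orthogonalGroup_transpose_mul hP
  have hQQ : Qᵀᵀ * Qᵀ = 1 := by
    rw [transpose_transpose]; exact mul_eq_one_comm.1 (orthogonalGroup_transpose_mul hQ)
  set X := P.submatrix id (Fin.castLE hm) with hX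
  have hXP : (1 - X * Xᵀ) * P = P * diagonal fun a : Fin m => if k ≤ (a : ℕ) then (1 : ℝ) else 0 := by
    have h1 : Xᵀ * P = (1 : Matrix (Fin m) (Fin m) ℝ).submatrix (Fin.castLE hm) id := by
      rw [← hPP]; rfl
    rw [Matrix.sub_mul, Matrix.one_mul, Matrix.mul_assoc, h1]
    ext i a
    rw [mul_diagonal, Matrix.sub_apply, mul_apply]
    have h2 (b : Fin k) : X i b * (1 : Matrix (Fin m) (Fin m) ℝ).submatrix (Fin.castLE hm) id b a =
        if (a : ℕ) = b then P i a else 0 := by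
      rw [submatrix_apply, one_apply, hX, submatrix_apply]
      by_cases hab : (a : ℕ) = b
      · have : Fin.castLE hm b = a := Fin.ext hab.symm
        simp [hab, this]
      · have : Fin.castLE hm b ≠ a := fun h => hab (by rw [← h]; rfl)
        simp [hab, this]
    simp only [h2]
    rw [sum_ite_val_eq (a : ℕ) (fun _ : Fin k => P i a)]
    by_cases hak : (a : ℕ) < k
    · simp [hak, not_le.2 hak]
    · simp [hak, not_lt.1 hak]
  rw [Matrix.mul_assoc, Matrix.mul_assoc, ← Matrix.mul_assoc _ P, hXP, Matrix.mul_assoc,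
    frobenius_norm_isometry_mul hPP]
  set C := Qᵀ * B with hC
  rw [← frobenius_norm_isometry_mul hQQ B, ← hC]
  refine le_of_sq_le_sq ?_ (by positivity)
  rw [frobenius_norm_sq_diagonal_mul, mul_pow, frobenius_norm_sq_eq_sum]
  calc _ ≤ ∑ a : Fin m, ∑ j, τ ^ 2 * ∑ b : Fin n, if (a : ℕ) = b then C b j ^ 2 else 0 := by
        refine Finset.sum_le_sum fun a _ => ?_
        rw [Finset.mul_sum]
        refine Finset.sum_le_sum fun j _ => ?_
        simp only [mul_apply, of_apply, ite_mul, zero_mul]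
        rw [sum_ite_val_eq (a : ℕ) (fun b => s a * C b j), sum_ite_val_eq]
        by_cases han : (a : ℕ) < n
        · by_cases hka : k ≤ (a : ℕ)
          · have := hs a hka a.2 han
            have h0 := hs0 a
            simp only [hka, if_true, han, dif_pos, mul_pow, one_pow, one_mul]
            gcongr
          · simp only [hka, if_false, han, dif_pos]
            rw [zero_pow two_ne_zero, zero_mul]
            positivity
        · simp [han]
    _ = τ ^ 2 * ∑ b : Fin n, ∑ j, ∑ a : Fin m, if (b : ℕ) = a then C b j ^ 2 else 0 := by
        simp only [← Finset.mul_sum]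
        congr 1
        rw [Finset.sum_comm, Finset.sum_congr rfl fun j _ => Finset.sum_comm, Finset.sum_comm]
        simp only [eq_comm]
    _ ≤ τ ^ 2 * ∑ b : Fin n, ∑ j, C b j ^ 2 := by
        gcongr with b _ j _
        rw [sum_ite_val_eq (b : ℕ) (fun _ : Fin m => C b j ^ 2)]
        split_ifs
        · exact le_rfl
        · positivity

/-- The spectral initialization captures the column space of `M` up to an error `O(k δ)`. -/
theorem RIP.norm_complement_init_le (hA : RIP A (2 * k) δ) (hδ : 0 ≤ δ) (hk : 0 < k)
    {M : Matrix (Fin m) (Fin n) ℝ} (hM : M.rank ≤ k) {P : Matrix (Fin n) (Fin n) ℝ}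
    (hP : M * P = M) (hPk : ‖P‖ ^ 2 ≤ k) {Smax : ℝ} (hSmax : 0 ≤ Smax)
    (hMk : ‖M‖ ^ 2 ≤ k * Smax ^ 2) {X : Matrix (Fin m) (Fin k) ℝ} {D : Matrix (Fin k) (Fin k) ℝ}
    {Y : Matrix (Fin n) (Fin k) ℝ} (h : IsTopSVD (∑ i, measurement A M i • A i) X D Y) :
    Xᵀ * X = 1 ∧ ‖(1 - X * Xᵀ) * M‖ ≤ 2 * (k * δ) * Smax := by
  obtain ⟨hm, -, U, s, Q, hsvd, rfl, -, -⟩ := h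
  have hXX := submatrix_transpose_mul_submatrix (orthogonalGroup_transpose_mul hsvd.1) hm
  refine ⟨hXX, ?_⟩
  have hnorm := hsvd.norm_complement_mul_le (τ := δ * ‖M‖) (by positivity)
    (fun i h1 h2 h3 => hA.tail_singularValue_le hδ hk hM hsvd h1 h2 h3) hm Pᵀ
  set N := ∑ i, measurement A M i • A i with hN
  set X := U.submatrix id (Fin.castLE hm)
  set R := 1 - X * Xᵀ with hR
  have hRs : Rᵀ = R := transpose_one_sub_mul_transpose X
  have hRR : R * R = R := isIdempotent_one_sub_mul_transpose hXX
  -- RIP is tested on `M` against `R M`, for which `⟨M, R M⟩ = ‖R M‖²`.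
  have h1 := (neg_abs_le _).trans' (neg_le_neg
    (hA.abs_inner_sub_le hM (Z := R * M) ((rank_mul_le_right _ _).trans hM) hδ))
  rw [← trace_sum_smul_transpose_mul, ← hN, ← frobenius_norm_sq_projection_mul hRs hRR] at h1
  -- `N` may have large rank; moving `P` onto it lets the tail operator bound cost only `‖P‖ ≤ √k`
  -- in Frobenius norm.
  have h2 : trace (Nᵀ * (R * M)) = trace ((R * (N * Pᵀ))ᵀ * (R * M)) := by
    rw [transpose_mul, transpose_mul, transpose_transpose, hRs, Matrix.mul_assoc, Matrix.mul_assoc,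
      trace_mul_comm P, Matrix.mul_assoc, ← Matrix.mul_assoc R R, hRR, Matrix.mul_assoc, hP]
  have h3 := trace_transpose_mul_le (R * (N * Pᵀ)) (R * M)
  rw [frobenius_norm_transpose] at hnorm
  have hsk : Real.sqrt k ^ 2 = k := Real.sq_sqrt (by positivity)
  have hsk1 : 1 ≤ Real.sqrt k := Real.one_le_sqrt.2 (by exact_mod_cast hk)
  have hP' : ‖P‖ ≤ Real.sqrt k := Real.le_sqrt_of_sq_le hPk
  have hM' : ‖M‖ ≤ Real.sqrt k * Smax := by
    refine le_of_sq_le_sq ?_ (by positivity)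
    rw [mul_pow, hsk]; exact hMk
  have hd : ‖R * M‖ ≤ δ * ‖M‖ * (1 + ‖P‖) := by
    rcases (norm_nonneg (R * M)).eq_or_lt with h0 | h0
    · rw [← h0]; positivity
    · refine le_of_mul_le_mul_right ?_ h0
      nlinarith [mul_le_mul_of_nonneg_right hnorm h0.le]
  calc ‖R * M‖ ≤ δ * ‖M‖ * (1 + ‖P‖) := hd
    _ ≤ δ * (Real.sqrt k * Smax) * (2 * Real.sqrt k) := by
        gcongr
        linarith
    _ = 2 * (k * δ) * Smax := by
        rw [← hsk]
        ring_nf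
        rw [Real.sqrt_sq (Real.sqrt_nonneg _)]

end Initialization

/-! ### The weighted loss and one block update. -/

section Loss

variable {m n p k : ℕ}

/-- The sign-dependent weighted square loss of the residual matrix `E`. -/
def residualLoss (A : Fin p → Matrix (Fin m) (Fin n) ℝ) (wpos wneg : Fin p → ℝ)
    (E : Matrix (Fin m) (Fin n) ℝ) : ℝ :=
  ∑ i, (if 0 ≤ measurement A E i then wpos i else wneg i) * measurement A E i ^ 2

/-- Half the derivative of `residualLoss` at `E` in the direction `H`. -/
def residualGrad (A : Fin p → Matrix (Fin m) (Fin n) ℝ) (wpos wneg : Fin p → ℝ)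
    (E H : Matrix (Fin m) (Fin n) ℝ) : ℝ :=
  ∑ i, (if 0 ≤ measurement A E i then wpos i else wneg i) * measurement A E i * measurement A H i

variable {A : Fin p → Matrix (Fin m) (Fin n) ℝ} {wpos wneg : Fin p → ℝ} {wlo whi : ℝ}

theorem objective_eq_residualLoss (M : Matrix (Fin m) (Fin n) ℝ) (X : Matrix (Fin m) (Fin k) ℝ)
    (Y : Matrix (Fin n) (Fin k) ℝ) :
    objective A (measurement A M) wpos wneg X Y = residualLoss A wpos wneg (M - X * Yᵀ) := by
  simp only [objective, residualLoss, measurement_sub]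

/-- Euler's identity for a positively 2-homogeneous function: it turns lower bounds on the slope
into multiples of the loss. -/
theorem residualGrad_self (E : Matrix (Fin m) (Fin n) ℝ) :
    residualGrad A wpos wneg E E = residualLoss A wpos wneg E := by
  simp only [residualGrad, residualLoss, mul_assoc, sq]

theorem residualGrad_add (E H K : Matrix (Fin m) (Fin n) ℝ) :
    residualGrad A wpos wneg E (H + K) =
      residualGrad A wpos wneg E H + residualGrad A wpos wneg E K := by
  simp only [residualGrad, measurement_add, mul_add, Finset.sum_add_distrib]

theorem residual_weight_mem (hpos : ∀ i, wpos i ∈ Set.Icc wlo whi)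
    (hneg : ∀ i, wneg i ∈ Set.Icc wlo whi) (r : ℝ) (i : Fin p) :
    (if 0 ≤ r then wpos i else wneg i) ∈ Set.Icc wlo whi := by
  split_ifs
  exacts [hpos i, hneg i]

theorem le_residualLoss (hpos : ∀ i, wpos i ∈ Set.Icc wlo whi)
    (hneg : ∀ i, wneg i ∈ Set.Icc wlo whi) (E : Matrix (Fin m) (Fin n) ℝ) :
    wlo * ‖measurement A E‖ ^ 2 ≤ residualLoss A wpos wneg E := by
  rw [norm_measurement_sq, residualLoss, Finset.mul_sum]
  exact Finset.sum_le_sum fun i _ =>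
    mul_le_mul_of_nonneg_right (residual_weight_mem hpos hneg _ i).1 (sq_nonneg _)

theorem residualLoss_le (hpos : ∀ i, wpos i ∈ Set.Icc wlo whi)
    (hneg : ∀ i, wneg i ∈ Set.Icc wlo whi) (E : Matrix (Fin m) (Fin n) ℝ) :
    residualLoss A wpos wneg E ≤ whi * ‖measurement A E‖ ^ 2 := by
  rw [norm_measurement_sq, residualLoss, Finset.mul_sum]
  exact Finset.sum_le_sum fun i _ =>
    mul_le_mul_of_nonneg_right (residual_weight_mem hpos hneg _ i).2 (sq_nonneg _)

theorem RIP.norm_sq_le_residualLoss (hpos : ∀ i, wpos i ∈ Set.Icc wlo whi)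
    (hneg : ∀ i, wneg i ∈ Set.Icc wlo whi) (hlo : 0 < wlo) {δ : ℝ}
    (hA : RIP A (2 * k) δ) (hδ : δ ≤ 1 / 2) {E : Matrix (Fin m) (Fin n) ℝ}
    (hE : E.rank ≤ 2 * k) : wlo * ‖E‖ ^ 2 ≤ 2 * residualLoss A wpos wneg E := by
  have h2 := (mul_le_mul_of_nonneg_left (hA E hE).1 hlo.le).trans (le_residualLoss hpos hneg E)
  nlinarith [mul_nonneg hlo.le (sq_nonneg ‖E‖)]

/-- Cauchy–Schwarz with the weights as measure; it shows that a small direction contributes little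
slope. -/
theorem residualGrad_sq_le (hpos : ∀ i, wpos i ∈ Set.Icc wlo whi)
    (hneg : ∀ i, wneg i ∈ Set.Icc wlo whi) (hlo : 0 ≤ wlo) (E H : Matrix (Fin m) (Fin n) ℝ) :
    residualGrad A wpos wneg E H ^ 2 ≤
      residualLoss A wpos wneg E * (whi * ‖measurement A H‖ ^ 2) := by
  have hw (i) := residual_weight_mem hpos hneg (measurement A E i) i
  refine (Finset.sum_sq_le_sum_mul_sum_of_sq_le_mul Finset.univ
    (f := fun i => (if 0 ≤ measurement A E i then wpos i else wneg i) * measurement A E i ^ 2)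
    (g := fun i => (if 0 ≤ measurement A E i then wpos i else wneg i) * measurement A H i ^ 2)
    (fun i _ => mul_nonneg (hlo.trans (hw i).1) (sq_nonneg _))
    (fun i _ => mul_nonneg (hlo.trans (hw i).1) (sq_nonneg _)) fun i _ => le_of_eq (by ring)).trans ?_
  refine mul_le_mul_of_nonneg_left ?_
    (Finset.sum_nonneg fun i _ => mul_nonneg (hlo.trans (hw i).1) (sq_nonneg _))
  rw [norm_measurement_sq, Finset.mul_sum]
  exact Finset.sum_le_sum fun i _ => mul_le_mul_of_nonneg_right (hw i).2 (sq_nonneg _)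

/-- The sign-dependent square `w(r) r²` is `2 b`-smooth when its two weights are at most `b`. -/
theorem signed_sq_smooth {u v b : ℝ} (hu : u ≤ b) (hv : v ≤ b) (r s : ℝ) :
    (if 0 ≤ r - s then u else v) * (r - s) ^ 2 ≤
      (if 0 ≤ r then u else v) * r ^ 2 - 2 * ((if 0 ≤ r then u else v) * r * s) + b * s ^ 2 := by
  by_cases hr : 0 ≤ r <;> by_cases hrs : 0 ≤ r - s <;> simp only [hr, hrs, if_true, if_false]
  · nlinarith [sq_nonneg s]
  · rw [not_le] at hrs
    -- After a sign change `0` lies between `r - s` and `r`, so `|r - s| ≤ |s|`. The right side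
    -- equals `u (r - s)² + (b - u) s²`, hence is at least `b (r - s)²`.
    have h : (r - s) ^ 2 ≤ s ^ 2 := by nlinarith
    nlinarith [sq_nonneg (r - s)]
  · rw [not_le] at hr
    have h : (r - s) ^ 2 ≤ s ^ 2 := by nlinarith
    nlinarith [sq_nonneg (r - s)]
  · nlinarith [sq_nonneg s]

/-- The descent inequality, summed from `signed_sq_smooth`. -/
theorem residualLoss_sub_smul_le (hpos : ∀ i, wpos i ∈ Set.Icc wlo whi)
    (hneg : ∀ i, wneg i ∈ Set.Icc wlo whi) (E H : Matrix (Fin m) (Fin n) ℝ) (t : ℝ) :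
    residualLoss A wpos wneg (E - t • H) ≤ residualLoss A wpos wneg E
      - 2 * t * residualGrad A wpos wneg E H + whi * t ^ 2 * ‖measurement A H‖ ^ 2 := by
  simp only [residualLoss, residualGrad, norm_measurement_sq, Finset.mul_sum,
    ← Finset.sum_sub_distrib, ← Finset.sum_add_distrib, measurement_sub, measurement_smul]
  refine Finset.sum_le_sum fun i _ =>
    (signed_sq_smooth (hpos i).2 (hneg i).2 (measurement A E i) (t * measurement A H i)).trans
      (le_of_eq ?_)
  ring

/-- First-order optimality along a line. -/
theorem residualGrad_eq_zero (hpos : ∀ i, wpos i ∈ Set.Icc wlo whi)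
    (hneg : ∀ i, wneg i ∈ Set.Icc wlo whi) {E H : Matrix (Fin m) (Fin n) ℝ}
    (h : ∀ t : ℝ, residualLoss A wpos wneg E ≤ residualLoss A wpos wneg (E - t • H)) :
    residualGrad A wpos wneg E H = 0 := by
  -- Minimality is compared with the quadratic upper model; its constant term is zero, so the
  -- discriminant forces the slope to vanish.
  have key (t : ℝ) : 0 ≤ (whi * ‖measurement A H‖ ^ 2) * (t * t) +
      (-2 * residualGrad A wpos wneg E H) * t + 0 := by
    have := (h t).trans (residualLoss_sub_smul_le hpos hneg E H t)
    linarith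
  have := discrim_le_zero key
  rw [discrim] at this
  exact pow_eq_zero_iff two_ne_zero |>.1 (le_antisymm (by linarith) (sq_nonneg _))

theorem rank_mul_transpose_le (X : Matrix (Fin m) (Fin k) ℝ) (Y : Matrix (Fin n) (Fin k) ℝ) :
    (X * Yᵀ).rank ≤ k :=
  (rank_mul_le_left _ _).trans (rank_le_width _)

theorem rank_sub_mul_transpose_le {M : Matrix (Fin m) (Fin n) ℝ} (hM : M.rank ≤ k)
    (X : Matrix (Fin m) (Fin k) ℝ) (Y : Matrix (Fin n) (Fin k) ℝ) :
    (M - X * Yᵀ).rank ≤ 2 * k := by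
  simpa [sub_eq_add_neg] using rank_add_smul_le hM (rank_mul_transpose_le X Y) (-1)

/-- The residual of a stationary `Y` splits into the part along `Ȳ`, a part to which the gradient is
orthogonal, and the block of `M` off both factors. -/
theorem residual_decomposition {M : Matrix (Fin m) (Fin n) ℝ} {X : Matrix (Fin m) (Fin k) ℝ}
    {Y Ybar : Matrix (Fin n) (Fin k) ℝ} (hX : Xᵀ * X = 1) :
    M - X * Yᵀ = (M - X * Yᵀ) * Ybar * Ybarᵀ
      + X * ((Xᵀ * ((M - X * Yᵀ) * (1 - Ybar * Ybarᵀ)))ᵀ)ᵀ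
      + (1 - X * Xᵀ) * M * (1 - Ybar * Ybarᵀ) := by
  have h1 : (1 - X * Xᵀ) * M = (1 - X * Xᵀ) * (M - X * Yᵀ) := by
    rw [Matrix.mul_sub _ M, ← Matrix.mul_assoc _ X, one_sub_mul_transpose_mul_self hX,
      Matrix.zero_mul, sub_zero]
  rw [h1, transpose_transpose]
  generalize M - X * Yᵀ = E
  simp only [Matrix.mul_sub, Matrix.sub_mul, Matrix.mul_one, Matrix.one_mul, Matrix.mul_assoc]
  abel

/-- One block update of alternating minimization, started at a residual that is stationary for the
other block and small, decreases the loss by a constant factor. -/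
theorem exists_residualLoss_le_mul (hpos : ∀ i, wpos i ∈ Set.Icc wlo whi)
    (hneg : ∀ i, wneg i ∈ Set.Icc wlo whi) (hlo : 0 < wlo) (hlohi : wlo ≤ whi) {δ : ℝ}
    (hA : RIP A (2 * k) δ) (hδ : δ ≤ 1 / 2) {M : Matrix (Fin m) (Fin n) ℝ} (hM : M.rank ≤ k)
    {Smin : ℝ} (hSmin : 0 < Smin) {P : Matrix (Fin n) (Fin n) ℝ} (hP : M * P = M)
    (hPB : ∀ B : Matrix (Fin n) (Fin n) ℝ, Smin * ‖P * B‖ ≤ ‖M * B‖)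
    {X : Matrix (Fin m) (Fin k) ℝ} {Y Ybar : Matrix (Fin n) (Fin k) ℝ} (hX : Xᵀ * X = 1)
    (hYbar : Ybarᵀ * Ybar = 1) {R : Matrix (Fin k) (Fin k) ℝ} (hY : Y = Ybar * R)
    (hgrad : ∀ Z : Matrix (Fin n) (Fin k) ℝ,
      residualGrad A wpos wneg (M - X * Yᵀ) (X * Zᵀ) = 0)
    (hsmall : 12 * whi * ‖M - X * Yᵀ‖ ^ 2 ≤ wlo * Smin ^ 2) :
    ∃ W : Matrix (Fin m) (Fin k) ℝ, residualLoss A wpos wneg (M - X * Yᵀ - W * Ybarᵀ) ≤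
      (1 - wlo / (12 * whi)) * residualLoss A wpos wneg (M - X * Yᵀ) := by
  have hhi : 0 < whi := hlo.trans_le hlohi
  have hdec := residual_decomposition (M := M) (Y := Y) (Ybar := Ybar) hX
  have hErank := rank_sub_mul_transpose_le hM X Y
  have hPM : (1 - X * Xᵀ) * M = (1 - X * Xᵀ) * (M - X * Yᵀ) := by
    rw [Matrix.mul_sub _ M, ← Matrix.mul_assoc _ X, one_sub_mul_transpose_mul_self hX,
      Matrix.zero_mul, sub_zero]
  have hMQ : M * (1 - Ybar * Ybarᵀ) = (M - X * Yᵀ) * (1 - Ybar * Ybarᵀ) := by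
    rw [Matrix.sub_mul M, hY, transpose_mul, Matrix.mul_assoc X, Matrix.mul_assoc Rᵀ,
      transpose_mul_one_sub_mul_transpose hYbar, Matrix.mul_zero, Matrix.mul_zero, sub_zero]
  set E := M - X * Yᵀ with hE
  set B := (1 - X * Xᵀ) * M * (1 - Ybar * Ybarᵀ) with hB
  set G := E * Ybar * Ybarᵀ with hG
  set f := residualLoss A wpos wneg E with hf
  set e := ‖E‖ with he
  have hfe : wlo * e ^ 2 ≤ 2 * f := hA.norm_sq_le_residualLoss hpos hneg hlo hδ hErank
  have hf0 : 0 ≤ f := by nlinarith [mul_nonneg hlo.le (sq_nonneg e)]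
  have hBle : ‖B‖ ≤ e ^ 2 / Smin := by
    refine (norm_mul_mul_le_div M hSmin hP hPB _ _).trans ?_
    gcongr
    rw [hPM, hMQ, sq]
    gcongr
    · exact frobenius_norm_projection_mul_le (transpose_one_sub_mul_transpose X)
        (isIdempotent_one_sub_mul_transpose hX) E
    · exact frobenius_norm_mul_projection_le (transpose_one_sub_mul_transpose Ybar)
        (isIdempotent_one_sub_mul_transpose hYbar) E
  have hBsq : ‖B‖ ^ 2 * Smin ^ 2 ≤ e ^ 4 := by
    rw [le_div_iff₀ hSmin] at hBle
    calc ‖B‖ ^ 2 * Smin ^ 2 = (‖B‖ * Smin) ^ 2 := by ring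
      _ ≤ (e ^ 2) ^ 2 := by gcongr
      _ = e ^ 4 := by ring
  have hBrank : B.rank ≤ 2 * k :=
    ((rank_mul_le_left _ _).trans (rank_mul_le_right _ _)).trans (by omega)
  have hGrank : G.rank ≤ 2 * k := (rank_mul_transpose_le _ _).trans (by omega)
  have hGle : ‖G‖ ≤ e := by
    rw [hG, frobenius_norm_mul_transpose_isometry hYbar]
    exact frobenius_norm_mul_isometry_le hYbar E
  have hup {H : Matrix (Fin m) (Fin n) ℝ} (hH : H.rank ≤ 2 * k) :
      ‖measurement A H‖ ^ 2 ≤ 3 / 2 * ‖H‖ ^ 2 :=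
    (hA H hH).2.trans (by gcongr; linarith)
  -- The `12` in `hsmall` gives `12 whi ‖B‖² ≤ wlo e² ≤ 2 f`; with the RIP factor `3/2`,
  -- Cauchy–Schwarz yields `f · f / 4`.
  have hgB : residualGrad A wpos wneg E B ^ 2 ≤ (f / 2) ^ 2 := by
    have h1 : whi * ‖B‖ ^ 2 * 12 ≤ wlo * e ^ 2 := by
      have h2 : (whi * ‖B‖ ^ 2 * 12) * Smin ^ 2 ≤ (wlo * e ^ 2) * Smin ^ 2 := by
        nlinarith [mul_le_mul_of_nonneg_left hBsq hhi.le,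
          mul_le_mul_of_nonneg_right hsmall (sq_nonneg e)]
      exact le_of_mul_le_mul_right h2 (by positivity)
    calc _ ≤ f * (whi * ‖measurement A B‖ ^ 2) := residualGrad_sq_le hpos hneg hlo.le E B
      _ ≤ f * (whi * (3 / 2 * ‖B‖ ^ 2)) := by gcongr; exact hup hBrank
      _ ≤ f * (f / 4) := by gcongr; linarith
      _ = (f / 2) ^ 2 := by ring
  have hgB' : residualGrad A wpos wneg E B ≤ f / 2 :=
    (le_abs_self _).trans (abs_le_of_sq_le_sq hgB (by positivity))
  have hgG : f / 2 ≤ residualGrad A wpos wneg E G := by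
    have : f = residualGrad A wpos wneg E G + residualGrad A wpos wneg E B := by
      calc f = residualGrad A wpos wneg E E := (residualGrad_self E).symm
        _ = _ := by
          nth_rewrite 2 [hdec]
          rw [residualGrad_add, residualGrad_add, hgrad, add_zero]
    linarith
  -- Step size `t = wlo / (6 whi)` along `G`: the linear term gains at least `t f`, the quadratic
  -- term loses at most `t f / 2`.
  refine ⟨(wlo / (6 * whi)) • (E * Ybar), ?_⟩
  rw [Matrix.smul_mul, ← hG]
  refine (residualLoss_sub_smul_le hpos hneg E G _).trans ?_
  set t := wlo / (6 * whi) with ht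
  have ht0 : 0 < t := by positivity
  have htw : wlo = 6 * whi * t := by rw [ht]; field_simp
  have h12 : wlo / (12 * whi) = t / 2 := by rw [ht]; ring
  have hmeas : whi * t ^ 2 * ‖measurement A G‖ ^ 2 ≤ t / 2 * f := by
    calc whi * t ^ 2 * ‖measurement A G‖ ^ 2 ≤ whi * t ^ 2 * (3 / 2 * e ^ 2) := by
          gcongr
          exact (hup hGrank).trans (by gcongr)
      _ = t / 4 * (wlo * e ^ 2) := by rw [htw]; ring
      _ ≤ t / 4 * (2 * f) := by gcongr
      _ = t / 2 * f := by ring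
  rw [h12]
  nlinarith

end Loss

/-! ### Linear convergence of the iteration. -/

section Convergence

variable {m n p k T : ℕ} {A : Fin p → Matrix (Fin m) (Fin n) ℝ} {wpos wneg : Fin p → ℝ}
  {wlo whi : ℝ} {M : Matrix (Fin m) (Fin n) ℝ}
  {Xbar Xhalf : ℕ → Matrix (Fin m) (Fin k) ℝ} {Ybar Yhalf : ℕ → Matrix (Fin n) (Fin k) ℝ}

theorem IsRun.residualGrad_eq_zero
    (hrun : IsRun A (measurement A M) wpos wneg T Xbar Xhalf Ybar Yhalf)
    (hpos : ∀ i, wpos i ∈ Set.Icc wlo whi) (hneg : ∀ i, wneg i ∈ Set.Icc wlo whi) {t : ℕ}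
    (ht : t < T) (Z : Matrix (Fin n) (Fin k) ℝ) :
    residualGrad A wpos wneg (M - Xbar t * (Yhalf t)ᵀ) (Xbar t * Zᵀ) = 0 := by
  refine WeightedMF.residualGrad_eq_zero hpos hneg fun s => ?_
  have := isMinOn_iff.1 (hrun.minY t ht) (Yhalf t + s • Z) (Set.mem_univ _)
  rw [objective_eq_residualLoss, objective_eq_residualLoss] at this
  refine this.trans_eq (congrArg _ ?_)
  rw [transpose_add, transpose_smul, Matrix.mul_add, Matrix.mul_smul, sub_sub]

theorem IsRun.residualLoss_Xhalf_le
    (hrun : IsRun A (measurement A M) wpos wneg T Xbar Xhalf Ybar Yhalf) {t : ℕ}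
    (ht : t < T) (X : Matrix (Fin m) (Fin k) ℝ) :
    residualLoss A wpos wneg (M - Xhalf t * (Ybar (t + 1))ᵀ) ≤
      residualLoss A wpos wneg (M - X * (Ybar (t + 1))ᵀ) := by
  have := isMinOn_iff.1 (hrun.minX t ht) X (Set.mem_univ _)
  rwa [objective_eq_residualLoss, objective_eq_residualLoss] at this

theorem IsRun.residualLoss_Yhalf_le
    (hrun : IsRun A (measurement A M) wpos wneg T Xbar Xhalf Ybar Yhalf) {t : ℕ}
    (ht : t < T) (Y : Matrix (Fin n) (Fin k) ℝ) :
    residualLoss A wpos wneg (M - Xbar t * (Yhalf t)ᵀ) ≤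
      residualLoss A wpos wneg (M - Xbar t * Yᵀ) := by
  have := isMinOn_iff.1 (hrun.minY t ht) Y (Set.mem_univ _)
  rwa [objective_eq_residualLoss, objective_eq_residualLoss] at this

/-- Linear convergence of the loss along alternating minimization. -/
theorem IsRun.residualLoss_le_pow_mul
    (hrun : IsRun A (measurement A M) wpos wneg T Xbar Xhalf Ybar Yhalf)
    (hpos : ∀ i, wpos i ∈ Set.Icc wlo whi) (hneg : ∀ i, wneg i ∈ Set.Icc wlo whi)
    (hlo : 0 < wlo) (hlohi : wlo ≤ whi) {δ : ℝ} (hA : RIP A (2 * k) δ) (hδ : δ ≤ 1 / 2)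
    (hM : M.rank ≤ k) {Smin : ℝ} (hSmin : 0 < Smin) {P : Matrix (Fin n) (Fin n) ℝ}
    (hP : M * P = M) (hPB : ∀ B : Matrix (Fin n) (Fin n) ℝ, Smin * ‖P * B‖ ≤ ‖M * B‖)
    (hX0 : (Xbar 0)ᵀ * Xbar 0 = 1) {f₀ : ℝ}
    (hf₀ : residualLoss A wpos wneg ((1 - Xbar 0 * (Xbar 0)ᵀ) * M) ≤ f₀)
    (hsmall : 24 * whi * f₀ ≤ wlo ^ 2 * Smin ^ 2) {t : ℕ} (ht : t < T) :
    residualLoss A wpos wneg (M - Xhalf t * (Ybar (t + 1))ᵀ) ≤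
      (1 - wlo / (12 * whi)) ^ (t + 1) * f₀ := by
  have hhi : 0 < whi := hlo.trans_le hlohi
  have hf₀0 : 0 ≤ f₀ :=
    (mul_nonneg hlo.le (sq_nonneg _)).trans ((le_residualLoss hpos hneg _).trans hf₀)
  set ρ := 1 - wlo / (12 * whi) with hρ
  have hdiv : wlo / (12 * whi) ≤ 1 := by
    rw [div_le_one (by positivity)]; linarith
  have hρ0 : 0 ≤ ρ := by linarith
  have hρ1 : ρ ≤ 1 := by
    have : 0 ≤ wlo / (12 * whi) := by positivity
    linarith
  have step {t : ℕ} (ht : t < T) (hX : (Xbar t)ᵀ * Xbar t = 1)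
      (ha : residualLoss A wpos wneg (M - Xbar t * (Yhalf t)ᵀ) ≤ ρ ^ t * f₀) :
      residualLoss A wpos wneg (M - Xhalf t * (Ybar (t + 1))ᵀ) ≤ ρ ^ (t + 1) * f₀ := by
    obtain ⟨hYbar, R, -, hR⟩ := hrun.qrY t ht
    have hE := hA.norm_sq_le_residualLoss hpos hneg hlo hδ
      (rank_sub_mul_transpose_le hM (Xbar t) (Yhalf t))
    have hf : residualLoss A wpos wneg (M - Xbar t * (Yhalf t)ᵀ) ≤ f₀ :=
      ha.trans (mul_le_of_le_one_left hf₀0 (pow_le_one₀ hρ0 hρ1))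
    have hs : 12 * whi * ‖M - Xbar t * (Yhalf t)ᵀ‖ ^ 2 ≤ wlo * Smin ^ 2 := by
      refine le_of_mul_le_mul_left ?_ hlo
      nlinarith [mul_le_mul_of_nonneg_left (hE.trans (mul_le_mul_of_nonneg_left hf zero_le_two))
        hhi.le]
    obtain ⟨W, hW⟩ := exists_residualLoss_le_mul hpos hneg hlo hlohi hA hδ hM hSmin hP hPB hX hYbar
      hR (hrun.residualGrad_eq_zero hpos hneg ht) hs
    -- Since `Yhalf t = Ȳ R`, the left factor `X̄ Rᵀ` reproduces the current product, so the descent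
    -- step `W` is an admissible change of `X`.
    have hmin := hrun.residualLoss_Xhalf_le ht (Xbar t * Rᵀ + W)
    rw [show M - (Xbar t * Rᵀ + W) * (Ybar (t + 1))ᵀ =
      M - Xbar t * (Yhalf t)ᵀ - W * (Ybar (t + 1))ᵀ by
        rw [hR, transpose_mul, Matrix.add_mul, Matrix.mul_assoc, sub_sub]] at hmin
    calc _ ≤ _ := hmin
      _ ≤ _ := hW
      _ ≤ ρ * (ρ ^ t * f₀) := by gcongr
      _ = ρ ^ (t + 1) * f₀ := by ring
  have main : ∀ t < T, (Xbar t)ᵀ * Xbar t = 1 ∧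
      residualLoss A wpos wneg (M - Xbar t * (Yhalf t)ᵀ) ≤ ρ ^ t * f₀ := by
    intro t
    induction t with
    | zero =>
      intro ht
      -- The competitor `Mᵀ X̄` leaves the residual `(1 - X̄ X̄ᵀ) M`.
      refine ⟨hX0, (hrun.residualLoss_Yhalf_le ht (Mᵀ * Xbar 0)).trans ?_⟩
      rw [pow_zero, one_mul, transpose_mul, transpose_transpose, ← Matrix.mul_assoc]
      rwa [Matrix.sub_mul, Matrix.one_mul] at hf₀
    | succ t ih =>
      intro ht
      have ht' : t < T := by omega
      obtain ⟨hX, ha⟩ := ih ht'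
      obtain ⟨hXbar, R, -, hR⟩ := hrun.qrX t ht'
      -- This competitor keeps the product from the preceding `X` update.
      refine ⟨hXbar, (hrun.residualLoss_Yhalf_le ht (Ybar (t + 1) * Rᵀ)).trans ?_⟩
      rw [transpose_mul, transpose_transpose, ← Matrix.mul_assoc, ← hR]
      exact step ht' hX ha
  exact step ht (main t ht).1 (main t ht).2

end Convergence

/-- If `T` is logarithmically large, then the geometric decay `ρ ^ T x ^ 2` is below `ε ^ 2`. -/
theorem pow_mul_sq_le_sq_of_log_le {ρ x ε : ℝ} (hρ0 : 0 < ρ) (hρ1 : ρ < 1) (hx : 0 < x)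
    (hε : 0 < ε) {T : ℕ} (hT : 2 / -Real.log ρ * (Real.log x - Real.log ε) ≤ T) :
    ρ ^ T * x ^ 2 ≤ ε ^ 2 := by
  have hlog : 0 < -Real.log ρ := neg_pos.2 (Real.log_neg hρ0 hρ1)
  rw [← Real.log_le_log_iff (by positivity) (by positivity),
    Real.log_mul (by positivity) (by positivity), Real.log_pow, Real.log_pow, Real.log_pow]
  rw [div_mul_eq_mul_div, div_le_iff₀ hlog] at hT
  push_cast
  linarith

end WeightedMF

end

/-! ### Choice of constants and conclusion. -/

theorem theorem1 (Smin Smax : ℝ) (hSmin : 0 < Smin) (hS : Smin ≤ Smax) :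
    ∃ C₁ : ℝ, 0 < C₁ ∧ ∃ C₂ : ℝ, 0 < C₂ ∧
      ∀ wlo whi : ℝ, 0 < wlo → wlo ≤ 1 / 2 → 1 / 2 ≤ whi → whi < 1 → wlo + whi = 1 →
        ∃ c : ℝ, 0 < c ∧
          ∀ (m n p k : ℕ) (A : Fin p → Matrix (Fin m) (Fin n) ℝ) (δ : ℝ)
            (M : Matrix (Fin m) (Fin n) ℝ),
            0 < k →
            0 < δ → δ < 1 → WeightedMF.RIP A (2 * k) δ →
            δ ≤ C₁ / (k : ℝ) * (wlo ^ 2 / whi ^ 2) →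
            M.rank ≤ k →
            (∀ i < M.rank, (Matrix.toEuclideanLin M).singularValues i ∈ Set.Icc Smin Smax) →
            ∀ wpos wneg : Fin p → ℝ,
              (∀ i, wpos i ∈ Set.Icc wlo whi) → (∀ i, wneg i ∈ Set.Icc wlo whi) →
              ∀ (T : ℕ) (Xbar Xhalf : ℕ → Matrix (Fin m) (Fin k) ℝ)
                (Ybar Yhalf : ℕ → Matrix (Fin n) (Fin k) ℝ),
                1 ≤ T →
                WeightedMF.IsRun A (WeightedMF.measurement A M) wpos wneg T
                  Xbar Xhalf Ybar Yhalf →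
                ∀ ε : ℝ, 0 < ε →
                  c * (Real.log (C₂ / ε) + Real.log (wlo / whi)) ≤ (T : ℝ) →
                  ‖Xhalf (T - 1) * (Ybar T)ᵀ - M‖ ≤ ε := by
  have hSmax : 0 < Smax := hSmin.trans_le hS
  -- With `q = wlo / whi`, this `C₁` turns the initialization error `2 k δ Smax` into at most `Smin
  -- q² / 6`.
  refine ⟨Smin / (12 * Smax), by positivity, Smin, hSmin, fun wlo whi hlo hlo2 hhi2 _ _ => ?_⟩
  have hlohi : wlo ≤ whi := hlo2.trans hhi2
  have hhi : 0 < whi := hlo.trans_le hlohi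
  have hθ0 : 0 < wlo / (12 * whi) := by positivity
  have hθ1 : wlo / (12 * whi) < 1 := by
    rw [div_lt_one (by positivity)]; linarith
  have hρ0 : 0 < 1 - wlo / (12 * whi) := by linarith
  have hρ1 : 1 - wlo / (12 * whi) < 1 := by linarith
  refine ⟨2 / -Real.log (1 - wlo / (12 * whi)),
    div_pos two_pos (neg_pos.2 (Real.log_neg hρ0 hρ1)), ?_⟩
  intro m n p k A δ M hk hδ0 _ hA hδ hM hs wpos wneg hpos hneg T Xbar Xhalf Ybar Yhalf hT hrun ε hε
    hlog
  obtain ⟨P, hP, hPk, hMk, hPB⟩ := WeightedMF.exists_rowSpace_projection M hM hSmin hs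
  obtain ⟨D, hinit⟩ := hrun.init
  obtain ⟨hX0, hX0M⟩ := hA.norm_complement_init_le hδ0.le hk hM hP hPk hSmax.le hMk hinit
  have hk' : (1 : ℝ) ≤ k := by exact_mod_cast hk
  set q := wlo / whi with hq
  have hq0 : 0 < q := by positivity
  have hq1 : q ≤ 1 := (div_le_one hhi).2 hlohi
  have hwq : wlo = q * whi := by rw [hq]; field_simp
  have hkδ : k * δ * (12 * Smax) ≤ Smin * q ^ 2 := by
    rw [← div_pow, ← hq] at hδ
    calc k * δ * (12 * Smax) ≤ k * (Smin / (12 * Smax) / k * q ^ 2) * (12 * Smax) := by gcongr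
      _ = Smin * q ^ 2 := by field_simp
  have hδ2 : δ ≤ 1 / 2 := by
    have h1 : δ * (12 * Smax) ≤ 1 * Smax := by
      calc δ * (12 * Smax) ≤ k * δ * (12 * Smax) := by
            gcongr; exact le_mul_of_one_le_left hδ0.le hk'
        _ ≤ Smin * q ^ 2 := hkδ
        _ ≤ Smax * 1 := by gcongr; exact pow_le_one₀ hq0.le hq1
        _ = 1 * Smax := by ring
    nlinarith
  have hinitle : ‖(1 - Xbar 0 * (Xbar 0)ᵀ) * M‖ ≤ Smin * q ^ 2 / 6 := by linarith
  have hf₀ : WeightedMF.residualLoss A wpos wneg ((1 - Xbar 0 * (Xbar 0)ᵀ) * M) ≤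
      whi * (Smin ^ 2 * q ^ 4 / 24) := by
    refine (WeightedMF.residualLoss_le hpos hneg _).trans ?_
    gcongr
    calc _ ≤ (1 + δ) * ‖(1 - Xbar 0 * (Xbar 0)ᵀ) * M‖ ^ 2 :=
          (hA _ ((Matrix.rank_mul_le_right _ _).trans (by omega))).2
      _ ≤ 3 / 2 * (Smin * q ^ 2 / 6) ^ 2 := by gcongr; linarith
      _ = Smin ^ 2 * q ^ 4 / 24 := by ring
  have hsmall : 24 * whi * (whi * (Smin ^ 2 * q ^ 4 / 24)) ≤ wlo ^ 2 * Smin ^ 2 := by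
    rw [hwq]
    calc 24 * whi * (whi * (Smin ^ 2 * q ^ 4 / 24)) = (q * whi) ^ 2 * Smin ^ 2 * q ^ 2 := by ring
      _ ≤ (q * whi) ^ 2 * Smin ^ 2 * 1 := by gcongr; exact pow_le_one₀ hq0.le hq1
      _ = _ := by ring
  have hfin := hrun.residualLoss_le_pow_mul hpos hneg hlo hlohi hA hδ2 hM hSmin hP hPB hX0 hf₀
    hsmall (t := T - 1) (by omega)
  rw [Nat.sub_add_cancel hT] at hfin
  have hE := hA.norm_sq_le_residualLoss hpos hneg hlo hδ2
    (WeightedMF.rank_sub_mul_transpose_le hM (Xhalf (T - 1)) (Ybar T))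
  rw [norm_sub_rev]
  refine le_of_sq_le_sq ?_ hε.le
  set ρ := 1 - wlo / (12 * whi) with hρ
  -- The term `log (wlo / whi)` is nonpositive and lowers the required `T`, so the prefactor must be
  -- `(Smin q)²` rather than `Smin²`. The factor `q⁴` in the initial loss provides this, even after
  -- division by `wlo = q whi`.
  calc ‖M - Xhalf (T - 1) * (Ybar T)ᵀ‖ ^ 2 ≤ ρ ^ T * (Smin * q) ^ 2 := by
        refine le_of_mul_le_mul_left (hE.trans ?_) hlo
        have : whi * (Smin ^ 2 * q ^ 4 / 24) ≤ wlo * (Smin * q) ^ 2 / 2 := by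
          rw [hwq]
          have h3 : 0 ≤ whi * Smin ^ 2 * q ^ 3 := by positivity
          nlinarith [mul_le_mul_of_nonneg_left hq1 h3]
        calc _ ≤ 2 * (ρ ^ T * (wlo * (Smin * q) ^ 2 / 2)) := by
              gcongr
              exact hfin.trans (by gcongr)
          _ = _ := by ring
    _ ≤ ε ^ 2 := by
        refine WeightedMF.pow_mul_sq_le_sq_of_log_le hρ0 hρ1 (by positivity) hε ?_
        rw [Real.log_div hSmin.ne' hε.ne'] at hlog
        rw [Real.log_mul hSmin.ne' hq0.ne']
        exact le_trans (le_of_eq (by ring)) hlog
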